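/- Let $\mathcal X$ be an exact Mal'tsev category, that is, a Barr exact category in which every internal reflexive relation is an equivalence relation. For equivalence relations on an object $X$ (seen as subobjects of $X\times X$), write $\wedge$ and $\vee$ for meets and joins in the lattice of equivalence relations on $X$; an empty meet is the largest equivalence relation $X\times X$. A finite collection $(R_i)_{i\in I}$ of equivalence relations on $X$ is called \emph{distributive} when, for all $k\geq 1$ and all pairwise disjoint subsets $J_0,J_1,\dots,J_k\subseteq I$, \[ \Big(\bigwedge_{j\in J_0}R_j\Big)\wedge\bigvee_{i=1}^k\Big(\bigwedge_{j\in J_i}R_j\Big)=\bigvee_{i=1}^k\Big(\bigwedge_{j\in J_0\cup J_i}R_j\Big). \] For equivalence relations $(R,r_1,r_2)$ and $(S,s_1,s_2)$ on $X$, let $R\,\square\,S$ be the pullback of $\langle r_1\times r_1,r_2\times r_2\rangle\colon R\times R\to X^4$ along $\langle s_1,s_2\rangle\times\langle s_1,s_2\rangle\colon S\times S\to X^4$, regarded as an equivalence relation on $S$: its elements are the pairs $((x,y),(t,z))$ of elements of $S$ such that $x\,R\,t$ and $y\,R\,z$. Let $n\geq 4$ and let $(R_i)_{0\leq i<n}$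 be a distributive $n$-tuple of equivalence relations on an object $X$ of $\mathcal X$. Then for every $m\in\{0,\dots,n-1\}$, the $(n-1)$-tuple $(R_i\,\square\,R_m)_{i\neq m}$ of equivalence relations on $R_m$ is again distributive. -/

import Mathlib

open CategoryTheory CategoryTheory.Limits

universe v u

namespace ExactMaltsev

/-- A Barr exact category: a regular category in which every internal equivalence relation is
effective, i.e. is a kernel pair. -/
class BarrExact (C : Type u) [Category.{v} C] : Prop extends Regular C where
  effective : ∀ {R X : C} (p₁ p₂ : R ⟶ X), IsEquivalenceRelation p₁ p₂ →
    ∃ (Y : C) (f : X ⟶ Y), IsKernelPair f p₁ p₂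

/-- A Mal'tsev category: a finitely complete category in which every internal reflexive relation
is an equivalence relation. -/
class IsMaltsev (C : Type u) [Category.{v} C] [HasFiniteLimits C] : Prop where
  isEquivalenceRelation : ∀ {R X : C} (p₁ p₂ : R ⟶ X), ReflexiveRelation p₁ p₂ →
    IsEquivalenceRelation p₁ p₂

section FiniteLimits

variable {C : Type u} [Category.{v} C] [HasFiniteLimits C]

/-- An (internal) equivalence relation on `X`, as a subobject of `X ⨯ X`. -/
@[ext]
structure EqRel (X : C) where
  rel : Subobject (X ⨯ X)
  isEquiv : IsEquivalenceRelation (rel.arrow ≫ prod.fst) (rel.arrow ≫ prod.snd)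

namespace EqRel

variable {X : C}

/-- The domain of an equivalence relation. -/
noncomputable abbrev dom (R : EqRel X) : C := (R.rel : C)

/-- The first projection of an equivalence relation. -/
noncomputable def p₁ (R : EqRel X) : R.dom ⟶ X := R.rel.arrow ≫ prod.fst

/-- The second projection of an equivalence relation. -/
noncomputable def p₂ (R : EqRel X) : R.dom ⟶ X := R.rel.arrow ≫ prod.snd

theorem lift_p₁_p₂ (R : EqRel X) : prod.lift R.p₁ R.p₂ = R.rel.arrow := by
  apply Limits.prod.hom_ext <;> simp only [prod.lift_fst, prod.lift_snd, p₁, p₂]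

instance (R : EqRel X) : Mono (prod.lift R.p₁ R.p₂) := by
  rw [lift_p₁_p₂]; infer_instance

/-- The relation induced on generalised elements `T ⟶ X`. -/
def Holds (R : EqRel X) {T : C} (a b : T ⟶ X) : Prop := R.rel.Factors (prod.lift a b)

theorem holds_iff (R : EqRel X) {T : C} (a b : T ⟶ X) :
    R.Holds a b ↔ ∃ c : T ⟶ R.dom, c ≫ R.p₁ = a ∧ c ≫ R.p₂ = b := by
  unfold Holds
  rw [Subobject.factors_iff]
  constructor
  · rintro ⟨c, hc⟩
    replace hc : c ≫ R.rel.arrow = prod.lift a b := hc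
    exact ⟨c, ((Category.assoc _ _ _).symm.trans (congrArg (· ≫ prod.fst) hc)).trans
        (prod.lift_fst a b),
      ((Category.assoc _ _ _).symm.trans (congrArg (· ≫ prod.snd) hc)).trans
        (prod.lift_snd a b)⟩
  · rintro ⟨c, rfl, rfl⟩
    refine ⟨c, ?_⟩
    change c ≫ R.rel.arrow = _
    rw [← lift_p₁_p₂, prod.comp_lift]

theorem refl (R : EqRel X) {T : C} (a : T ⟶ X) : R.Holds a a := by
  obtain ⟨⟨e⟩⟩ := R.isEquiv
  refine (R.holds_iff a a).2 ⟨a ≫ e.r, ?_, ?_⟩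
  · exact (Category.assoc _ _ _).trans ((congrArg (a ≫ ·) e.reflexivity₁).trans (Category.comp_id a))
  · exact (Category.assoc _ _ _).trans ((congrArg (a ≫ ·) e.reflexivity₂).trans (Category.comp_id a))

theorem symm (R : EqRel X) {T : C} {a b : T ⟶ X} (h : R.Holds a b) : R.Holds b a := by
  obtain ⟨⟨e⟩⟩ := R.isEquiv
  obtain ⟨c, rfl, rfl⟩ := (R.holds_iff a b).1 h
  refine (R.holds_iff _ _).2 ⟨c ≫ e.s, ?_, ?_⟩
  · exact (Category.assoc _ _ _).trans (congrArg (c ≫ ·) e.symmetry₁)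
  · exact (Category.assoc _ _ _).trans (congrArg (c ≫ ·) e.symmetry₂)

theorem trans (R : EqRel X) {T : C} {a b c : T ⟶ X} (h : R.Holds a b) (h' : R.Holds b c) :
    R.Holds a c := by
  obtain ⟨⟨e⟩⟩ := R.isEquiv
  obtain ⟨f, rfl, hf⟩ := (R.holds_iff _ _).1 h
  obtain ⟨g, hg, rfl⟩ := (R.holds_iff _ _).1 h'
  have w : f ≫ R.rel.arrow ≫ prod.snd = g ≫ R.rel.arrow ≫ prod.fst := hf.trans hg.symm
  let k := PullbackCone.IsLimit.lift e.isLimit f g w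
  refine (R.holds_iff _ _).2 ⟨k ≫ e.t, ?_, ?_⟩
  · have h1 : k ≫ e.c.fst = f := PullbackCone.IsLimit.lift_fst _ _ _ _
    exact (Category.assoc _ _ _).trans ((congrArg (k ≫ ·) e.transitivity₁).trans
      ((Category.assoc _ _ _).symm.trans (congrArg (· ≫ R.p₁) h1)))
  · have h1 : k ≫ e.c.snd = g := PullbackCone.IsLimit.lift_snd _ _ _ _
    exact (Category.assoc _ _ _).trans ((congrArg (k ≫ ·) e.transitivity₂).trans
      ((Category.assoc _ _ _).symm.trans (congrArg (· ≫ R.p₂) h1)))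

theorem jointlyMono (S : Subobject (X ⨯ X)) :
    JointlyMono₂ (S.arrow ≫ prod.fst) (S.arrow ≫ prod.snd) where
  right_cancellation Y f g h₁ h₂ := by
    rw [← cancel_mono S.arrow]
    ext
    · simpa using h₁
    · simpa using h₂

/-- A subobject of `X ⨯ X` that is reflexive, symmetric and transitive on generalised elements is
an equivalence relation. -/
theorem isEquivalenceRelation_of (S : Subobject (X ⨯ X))
    (refl : ∀ {T : C} (a : T ⟶ X), S.Factors (prod.lift a a))
    (symm : ∀ {T : C} (a b : T ⟶ X), S.Factors (prod.lift a b) → S.Factors (prod.lift b a))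
    (trans : ∀ {T : C} (a b c : T ⟶ X), S.Factors (prod.lift a b) → S.Factors (prod.lift b c) →
      S.Factors (prod.lift a c)) :
    IsEquivalenceRelation (S.arrow ≫ prod.fst) (S.arrow ≫ prod.snd) := by
  have hS : prod.lift (S.arrow ≫ prod.fst) (S.arrow ≫ prod.snd) = S.arrow := by
    apply Limits.prod.hom_ext <;> simp only [prod.lift_fst, prod.lift_snd]
  have hs := symm (S.arrow ≫ prod.fst) (S.arrow ≫ prod.snd) (by
    rw [hS]; exact Subobject.factors_self S)
  have ht := trans
    (pullback.fst (S.arrow ≫ prod.snd) (S.arrow ≫ prod.fst) ≫ S.arrow ≫ prod.fst)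
    (pullback.fst (S.arrow ≫ prod.snd) (S.arrow ≫ prod.fst) ≫ S.arrow ≫ prod.snd)
    (pullback.snd (S.arrow ≫ prod.snd) (S.arrow ≫ prod.fst) ≫ S.arrow ≫ prod.snd)
    (by rw [← prod.comp_lift, hS]; exact Subobject.factors_comp_arrow _)
    (by rw [pullback.condition, ← prod.comp_lift, hS]; exact Subobject.factors_comp_arrow _)
  exact ⟨⟨{
    jointlyMono S with
    r := S.factorThru _ (refl (𝟙 X))
    reflexivity₁ := by rw [Subobject.factorThru_arrow_assoc, prod.lift_fst]
    reflexivity₂ := by rw [Subobject.factorThru_arrow_assoc, prod.lift_snd]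
    s := S.factorThru _ hs
    symmetry₁ := by rw [Subobject.factorThru_arrow_assoc, prod.lift_fst]
    symmetry₂ := by rw [Subobject.factorThru_arrow_assoc, prod.lift_snd]
    c := _
    isLimit := pullback.isLimit (S.arrow ≫ prod.snd) (S.arrow ≫ prod.fst)
    t := S.factorThru _ ht
    transitivity₁ := by rw [Subobject.factorThru_arrow_assoc, prod.lift_fst]; rfl
    transitivity₂ := by rw [Subobject.factorThru_arrow_assoc, prod.lift_snd]; rfl }⟩⟩

/-- Equivalence relations on `X` are ordered by inclusion. -/
noncomputable instance : PartialOrder (EqRel X) := PartialOrder.lift EqRel.rel fun _ _ => EqRel.ext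

theorem le_iff_holds (R S : EqRel X) :
    R ≤ S ↔ ∀ {T : C} (a b : T ⟶ X), R.Holds a b → S.Holds a b := by
  constructor
  · intro h T a b hab
    exact Subobject.factors_of_le _ h hab
  · intro h
    have := h R.p₁ R.p₂ ((R.holds_iff _ _).2 ⟨𝟙 _, by simp, by simp⟩)
    unfold Holds at this
    rw [lift_p₁_p₂] at this
    exact Subobject.le_of_factors this

/-- The meet of two equivalence relations is their intersection. -/
noncomputable instance : SemilatticeInf (EqRel X) where
  inf R S :=
    { rel := R.rel ⊓ S.rel
      isEquiv := isEquivalenceRelation_of _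
        (fun a => (Subobject.inf_factors _).2 ⟨R.refl a, S.refl a⟩)
        (fun _ _ h => (Subobject.inf_factors _).2
          ⟨R.symm ((Subobject.inf_factors _).1 h).1, S.symm ((Subobject.inf_factors _).1 h).2⟩)
        (fun _ _ _ h h' => (Subobject.inf_factors _).2
          ⟨R.trans ((Subobject.inf_factors _).1 h).1 ((Subobject.inf_factors _).1 h').1,
            S.trans ((Subobject.inf_factors _).1 h).2 ((Subobject.inf_factors _).1 h').2⟩) }
  inf_le_left R S := (inf_le_left : R.rel ⊓ S.rel ≤ R.rel)
  inf_le_right R S := (inf_le_right : R.rel ⊓ S.rel ≤ S.rel)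
  le_inf R S T h h' := (le_inf h h' : R.rel ≤ S.rel ⊓ T.rel)

/-- The largest equivalence relation `X ⨯ X`. -/
noncomputable instance : OrderTop (EqRel X) where
  top :=
    { rel := ⊤
      isEquiv := isEquivalenceRelation_of _ (fun _ => Subobject.top_factors _)
        (fun _ _ _ => Subobject.top_factors _) (fun _ _ _ _ _ => Subobject.top_factors _) }
  le_top R := (le_top : R.rel ≤ ⊤)

theorem diag_factors_iff {T : C} (a b : T ⟶ X) :
    (Subobject.mk (diag X)).Factors (prod.lift a b) ↔ a = b := by
  rw [Subobject.mk_factors_iff]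
  constructor
  · intro h
    obtain ⟨c, hc'⟩ : ∃ c : T ⟶ X, c ≫ prod.lift (𝟙 X) (𝟙 X) = prod.lift a b := h
    rw [prod.comp_lift, Category.comp_id] at hc'
    have h₁ := congrArg (· ≫ prod.fst) hc'
    have h₂ := congrArg (· ≫ prod.snd) hc'
    simp only [prod.lift_fst, prod.lift_snd] at h₁ h₂
    exact h₁.symm.trans h₂
  · rintro rfl
    refine ⟨a, ?_⟩
    change a ≫ prod.lift (𝟙 X) (𝟙 X) = _
    rw [prod.comp_lift, Category.comp_id]

/-- The smallest equivalence relation, the diagonal of `X`. -/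
noncomputable instance : OrderBot (EqRel X) where
  bot :=
    { rel := Subobject.mk (diag X)
      isEquiv := isEquivalenceRelation_of _ (fun _ => (diag_factors_iff _ _).2 rfl)
        (fun _ _ h => (diag_factors_iff _ _).2 ((diag_factors_iff _ _).1 h).symm)
        (fun _ _ _ h h' => (diag_factors_iff _ _).2
          (((diag_factors_iff _ _).1 h).trans ((diag_factors_iff _ _).1 h'))) }
  bot_le R := by
    refine Subobject.mk_le_of_comm (R.rel.factorThru _ (R.refl (𝟙 X))) ?_
    exact Subobject.factorThru_arrow _ _ _

end EqRel

variable {X : C}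

/-- The subobject of `S × S` underlying `R □ S`: the pullback along
`⟨s₁, s₂⟩ × ⟨s₁, s₂⟩ : S × S ⟶ X⁴` of the monomorphism `⟨r₁ × r₁, r₂ × r₂⟩ : R × R ⟶ X⁴`. -/
noncomputable def squareRel (R S : EqRel X) : Subobject (S.dom ⨯ S.dom) :=
  haveI : Mono (prod.lift (prod.map R.p₁ R.p₁) (prod.map R.p₂ R.p₂)) := by
    refine ⟨fun {Z} g h w => ?_⟩
    have w₁ := congrArg (· ≫ prod.fst) w
    have w₂ := congrArg (· ≫ prod.snd) w
    simp only [Category.assoc, prod.lift_fst, prod.lift_snd] at w₁ w₂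
    have w₁₁ := congrArg (· ≫ prod.fst) w₁
    have w₁₂ := congrArg (· ≫ prod.snd) w₁
    have w₂₁ := congrArg (· ≫ prod.fst) w₂
    have w₂₂ := congrArg (· ≫ prod.snd) w₂
    simp only [Category.assoc, prod.map_fst, prod.map_snd] at w₁₁ w₁₂ w₂₁ w₂₂
    apply Limits.prod.hom_ext
    · rw [← cancel_mono (prod.lift R.p₁ R.p₂), prod.comp_lift, prod.comp_lift]
      simp only [Category.assoc, w₁₁, w₂₁]
    · rw [← cancel_mono (prod.lift R.p₁ R.p₂), prod.comp_lift, prod.comp_lift]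
      simp only [Category.assoc, w₁₂, w₂₂]
  (Subobject.pullback (prod.map (prod.lift S.p₁ S.p₂) (prod.lift S.p₁ S.p₂))).obj
    (Subobject.mk (prod.lift (prod.map R.p₁ R.p₁) (prod.map R.p₂ R.p₂)))

theorem EqRel.pullback_factors_iff {A B T : C} (f : A ⟶ B) (P : Subobject B) (g : T ⟶ A) :
    ((Subobject.pullback f).obj P).Factors g ↔ P.Factors (g ≫ f) := by
  have hp := Subobject.isPullback f P
  rw [Subobject.factors_iff, Subobject.factors_iff]
  constructor
  · rintro ⟨c, hc⟩
    have hc' : c ≫ ((Subobject.pullback f).obj P).arrow = g := hc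
    refine ⟨c ≫ Subobject.pullbackπ f P, ?_⟩
    exact (Category.assoc _ _ _).trans ((congrArg (c ≫ ·) hp.w).trans
      ((Category.assoc _ _ _).symm.trans (congrArg (· ≫ f) hc')))
  · rintro ⟨c, hc⟩
    exact ⟨hp.lift c g hc, hp.lift_snd c g hc⟩

/-- In terms of generalised elements: `(x, y)` and `(t, z)` in `S` are related by `R □ S` if and
only if `x R t` and `y R z`. -/
theorem squareRel_factors_iff (R S : EqRel X) {T : C} (a b : T ⟶ S.dom) :
    (squareRel R S).Factors (prod.lift a b) ↔
      R.Holds (a ≫ S.p₁) (b ≫ S.p₁) ∧ R.Holds (a ≫ S.p₂) (b ≫ S.p₂) := by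
  unfold squareRel
  rw [EqRel.pullback_factors_iff, Subobject.mk_factors_iff, R.holds_iff, R.holds_iff]
  constructor
  · intro h
    obtain ⟨c, hc⟩ : ∃ c : T ⟶ R.dom ⨯ R.dom,
      c ≫ prod.lift (prod.map R.p₁ R.p₁) (prod.map R.p₂ R.p₂) =
        prod.lift a b ≫ prod.map (prod.lift S.p₁ S.p₂) (prod.lift S.p₁ S.p₂) := h
    rw [prod.comp_lift, prod.lift_map, prod.comp_lift, prod.comp_lift] at hc
    have h₁ := congrArg (· ≫ prod.fst) hc
    have h₂ := congrArg (· ≫ prod.snd) hc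
    simp only [prod.lift_fst, prod.lift_snd] at h₁ h₂
    have h₁₁ := congrArg (· ≫ prod.fst) h₁
    have h₁₂ := congrArg (· ≫ prod.snd) h₁
    have h₂₁ := congrArg (· ≫ prod.fst) h₂
    have h₂₂ := congrArg (· ≫ prod.snd) h₂
    simp only [Category.assoc, prod.map_fst, prod.map_snd, prod.lift_fst, prod.lift_snd]
      at h₁₁ h₁₂ h₂₁ h₂₂
    exact ⟨⟨c ≫ prod.fst, (Category.assoc _ _ _).trans h₁₁, (Category.assoc _ _ _).trans h₂₁⟩,
      ⟨c ≫ prod.snd, (Category.assoc _ _ _).trans h₁₂, (Category.assoc _ _ _).trans h₂₂⟩⟩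
  · rintro ⟨⟨c, h₁, h₂⟩, ⟨d, h₃, h₄⟩⟩
    refine ⟨prod.lift c d, ?_⟩
    change prod.lift c d ≫ prod.lift (prod.map R.p₁ R.p₁) (prod.map R.p₂ R.p₂) = _
    rw [prod.comp_lift, prod.lift_map, prod.lift_map, prod.lift_map, prod.comp_lift,
      prod.comp_lift, h₁, h₂, h₃, h₄]

/-- The parallelistic double equivalence relation `R □ S`, as an equivalence relation on `S`. -/
noncomputable def square (R S : EqRel X) : EqRel S.dom where
  rel := squareRel R S
  isEquiv := EqRel.isEquivalenceRelation_of _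
    (fun _ => (squareRel_factors_iff R S _ _).2 ⟨R.refl _, R.refl _⟩)
    (fun _ _ h =>
      have h := (squareRel_factors_iff R S _ _).1 h
      (squareRel_factors_iff R S _ _).2 ⟨R.symm h.1, R.symm h.2⟩)
    (fun _ _ _ h h' =>
      have h := (squareRel_factors_iff R S _ _).1 h
      have h' := (squareRel_factors_iff R S _ _).1 h'
      (squareRel_factors_iff R S _ _).2 ⟨R.trans h.1 h'.1, R.trans h.2 h'.2⟩)

end FiniteLimits

section Regular

variable {C : Type u} [Category.{v} C] [Regular C] {X : C}

/-- The composite of two equivalence relations `R` and `S`: the image of `R ×_X S ⟶ X ⨯ X`. -/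
noncomputable def compRel (R S : EqRel X) : Subobject (X ⨯ X) :=
  imageSubobject (prod.lift (pullback.fst R.p₂ S.p₁ ≫ R.p₁) (pullback.snd R.p₂ S.p₁ ≫ S.p₂))

theorem compRel_factors (R S : EqRel X) {T : C} {a b c : T ⟶ X} (h : R.Holds a b)
    (h' : S.Holds b c) : (compRel R S).Factors (prod.lift a c) := by
  obtain ⟨f, rfl, hf⟩ := (R.holds_iff _ _).1 h
  obtain ⟨g, hg, rfl⟩ := (S.holds_iff _ _).1 h'
  have := imageSubobject_factors_comp_self
    (prod.lift (pullback.fst R.p₂ S.p₁ ≫ R.p₁) (pullback.snd R.p₂ S.p₁ ≫ S.p₂))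
    (pullback.lift f g (hf.trans hg.symm))
  rw [prod.comp_lift, ← Category.assoc, ← Category.assoc, pullback.lift_fst,
    pullback.lift_snd] at this
  exact this

/-- In a regular Mal'tsev category, equivalence relations on an object form a lattice, where the
join of `R` and `S` is their composite. -/
noncomputable instance [IsMaltsev C] : Lattice (EqRel X) where
  __ := (inferInstance : SemilatticeInf (EqRel X))
  sup R S :=
    { rel := compRel R S
      isEquiv := IsMaltsev.isEquivalenceRelation _ _
        { EqRel.jointlyMono (compRel R S) with
          r := (compRel R S).factorThru _ (compRel_factors R S (R.refl (𝟙 X)) (S.refl (𝟙 X)))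
          reflexivity₁ := by rw [Subobject.factorThru_arrow_assoc, prod.lift_fst]
          reflexivity₂ := by rw [Subobject.factorThru_arrow_assoc, prod.lift_snd] } }
  le_sup_left R S := (EqRel.le_iff_holds _ _).2 fun _ b h => compRel_factors R S h (S.refl b)
  le_sup_right R S := (EqRel.le_iff_holds _ _).2 fun a _ h => compRel_factors R S (R.refl a) h
  sup_le R S T hR hS := by
    have h : T.Holds (pullback.fst R.p₂ S.p₁ ≫ R.p₁) (pullback.snd R.p₂ S.p₁ ≫ S.p₂) :=
      T.trans ((EqRel.le_iff_holds _ _).1 hR _ _ ((R.holds_iff _ _).2 ⟨_, rfl, rfl⟩))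
        ((EqRel.le_iff_holds _ _).1 hS _ _
          ((S.holds_iff _ _).2 ⟨_, pullback.condition.symm, rfl⟩))
    exact imageSubobject_le _ (T.rel.factorThru _ h) (Subobject.factorThru_arrow _ _ h)

/-- A collection `(R_i)` of equivalence relations on `X` is distributive when, for all pairwise
disjoint finite `J₀, J₁, …, J_k` with `k ≥ 1`,
`(⋀_{J₀} R_j) ∧ ⋁_{i=1}^k (⋀_{J_i} R_j) = ⋁_{i=1}^k (⋀_{J₀ ∪ J_i} R_j)`. An empty meet is the
largest equivalence relation. -/
def IsDistributive [IsMaltsev C] {ι : Type*} [DecidableEq ι] (R : ι → EqRel X) : Prop :=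
  ∀ (k : ℕ), 1 ≤ k → ∀ J : Fin (k + 1) → Finset ι, (∀ i j, i ≠ j → Disjoint (J i) (J j)) →
    (J 0).inf R ⊓ Finset.univ.sup (fun i : Fin k => (J i.succ).inf R) =
      Finset.univ.sup (fun i : Fin k => (J 0 ∪ J i.succ).inf R)

end Regular

end ExactMaltsev

/-!
For a fixed equivalence relation `S` on `X`, the operation `R ↦ R □ S` preserves finite meets. It
also preserves order, but it preserves a join `R ⊔ T` only under a condition: given `(x, y)` and
`(t, z)` in `S` with `x R u T t` and `y R v T z`, the pair `(u, v)` need not lie in `S`. It does lie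
in `(S ⊔ R) ⊓ (S ⊔ T)`, so if this meet equals `S ⊔ (R ⊓ T)`, then there is `w` with `u S w` and
`w (R ⊓ T) v`. In that case `w` can replace `v`, and `(u, w)` links `(x, y)` to `(t, z)` in the join
of `R □ S` and `T □ S`; this is `square_sup`. The middle points `u`, `v`, `w` exist only after
passing to covers, which are harmless because equivalence relations satisfy descent along regular
epimorphisms (`EqRel.Holds.of_comp_regularEpi`).

In a Mal'tsev category the lattice of equivalence relations is modular because joins are composites,
and in a modular lattice the required condition on the triple `S, R, T` follows from
`S ⊓ (R ⊔ T) = (S ⊓ R) ⊔ (S ⊓ T)` (`sup_inf_sup_le_of_inf_sup_eq`). Distributivity of the tuple,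
applied with `m` added to `J₀`, supplies this identity for the joins at hand, with `S = R_m`. Hence
`- □ R_m` carries each instance of the distributive law on `X` to the one required on `R_m`.
-/

section Lattice

/-- In a modular lattice, one distributive law for a triple of elements implies the dual one. -/
theorem sup_inf_sup_le_of_inf_sup_eq {α : Type*} [Lattice α] [IsModularLattice α] {s r t : α}
    (h : s ⊓ (r ⊔ t) = s ⊓ r ⊔ s ⊓ t) : (s ⊔ r) ⊓ (s ⊔ t) ≤ s ⊔ r ⊓ t := by
  refine (sup_inf_le_assoc_of_le r le_sup_left).trans (sup_le le_sup_left ?_)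
  have h₁ : r ⊓ (s ⊔ t) ≤ s ⊓ r ⊔ t :=
    calc r ⊓ (s ⊔ t) ≤ (t ⊔ s) ⊓ (r ⊔ t) :=
          le_inf (inf_le_right.trans (sup_comm _ _).le) (inf_le_left.trans le_sup_left)
      _ ≤ t ⊔ s ⊓ (r ⊔ t) := sup_inf_le_assoc_of_le s le_sup_right
      _ ≤ s ⊓ r ⊔ t := by
          rw [h]
          exact sup_le le_sup_right (sup_le le_sup_left (inf_le_right.trans le_sup_right))
  calc r ⊓ (s ⊔ t) ≤ (s ⊓ r ⊔ t) ⊓ r := le_inf h₁ inf_le_left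
    _ ≤ s ⊓ r ⊔ t ⊓ r := sup_inf_le_assoc_of_le t inf_le_right
    _ ≤ s ⊔ r ⊓ t := sup_le_sup inf_le_left (inf_comm _ _).le

end Lattice

namespace ExactMaltsev

section FiniteLimits

variable {C : Type u} [Category.{v} C] [HasFiniteLimits C] {X : C}

theorem EqRel.Holds.comp {R : EqRel X} {T T' : C} {a b : T ⟶ X} (h : R.Holds a b) (f : T' ⟶ T) :
    R.Holds (f ≫ a) (f ≫ b) := by
  unfold EqRel.Holds at h ⊢
  rw [← prod.comp_lift]
  exact Subobject.factors_of_factors_right f h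

theorem EqRel.inf_holds_iff {R S : EqRel X} {T : C} {a b : T ⟶ X} :
    (R ⊓ S).Holds a b ↔ R.Holds a b ∧ S.Holds a b :=
  Subobject.inf_factors _

/-- Descent: a strong epimorphism lifts against the monomorphism `R ⟶ X ⨯ X`. -/
theorem EqRel.Holds.of_comp_regularEpi {R : EqRel X} {T T' : C} {a b : T ⟶ X} (e : T' ⟶ T)
    [IsRegularEpi e] (h : R.Holds (e ≫ a) (e ≫ b)) : R.Holds a b := by
  unfold EqRel.Holds at h ⊢
  rw [← prod.comp_lift] at h
  have sq : CommSq (R.rel.factorThru _ h) e R.rel.arrow (prod.lift a b) :=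
    ⟨Subobject.factorThru_arrow _ _ h⟩
  exact (Subobject.factors_iff _ _).2 ⟨sq.lift, sq.fac_right⟩

theorem square_holds_iff {R S : EqRel X} {T : C} {a b : T ⟶ S.dom} :
    (square R S).Holds a b ↔
      R.Holds (a ≫ S.p₁) (b ≫ S.p₁) ∧ R.Holds (a ≫ S.p₂) (b ≫ S.p₂) :=
  squareRel_factors_iff R S a b

theorem square_mono {R T : EqRel X} (S : EqRel X) (h : R ≤ T) : square R S ≤ square T S :=
  (EqRel.le_iff_holds _ _).2 fun _ _ hab =>
    have h' := (EqRel.le_iff_holds _ _).1 h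
    square_holds_iff.2 ⟨h' _ _ (square_holds_iff.1 hab).1, h' _ _ (square_holds_iff.1 hab).2⟩

theorem square_inf (R T S : EqRel X) : square (R ⊓ T) S = square R S ⊓ square T S :=
  le_antisymm (le_inf (square_mono S inf_le_left) (square_mono S inf_le_right))
    ((EqRel.le_iff_holds _ _).2 fun _ _ hab => by
      obtain ⟨h₁, h₂⟩ := EqRel.inf_holds_iff.1 hab
      rw [square_holds_iff] at h₁ h₂
      exact square_holds_iff.2
        ⟨EqRel.inf_holds_iff.2 ⟨h₁.1, h₂.1⟩, EqRel.inf_holds_iff.2 ⟨h₁.2, h₂.2⟩⟩)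

theorem square_top (S : EqRel X) : square ⊤ S = ⊤ :=
  top_le_iff.1 ((EqRel.le_iff_holds _ _).2 fun _ _ _ =>
    square_holds_iff.2 ⟨Subobject.top_factors _, Subobject.top_factors _⟩)

theorem square_bot (S : EqRel X) : square ⊥ S = ⊥ :=
  le_bot_iff.1 ((EqRel.le_iff_holds _ _).2 fun a b hab => by
    obtain ⟨h₁, h₂⟩ := square_holds_iff.1 hab
    refine (EqRel.diag_factors_iff a b).2 ?_
    rw [← cancel_mono (prod.lift S.p₁ S.p₂), prod.comp_lift, prod.comp_lift,
      (EqRel.diag_factors_iff _ _).1 h₁, (EqRel.diag_factors_iff _ _).1 h₂])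

theorem square_finset_inf {ι : Type*} (J : Finset ι) (R : ι → EqRel X) (S : EqRel X) :
    square (J.inf R) S = J.inf fun i => square (R i) S :=
  Finset.apply_inf_eq_inf_comp (fun T => square T S) (fun _ _ => square_inf _ _ S) (square_top S)

end FiniteLimits

section Regular

variable {C : Type u} [Category.{v} C] [Regular C] [IsMaltsev C] {X : C}

/-- The join is the composite, so on generalised elements it is witnessed by a middle point after
passing to a cover. -/
theorem EqRel.sup_holds_iff {R S : EqRel X} {T : C} {a b : T ⟶ X} :
    (R ⊔ S).Holds a b ↔ ∃ (T' : C) (e : T' ⟶ T) (_ : IsRegularEpi e) (c : T' ⟶ X),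
      R.Holds (e ≫ a) c ∧ S.Holds c (e ≫ b) := by
  constructor
  · intro h
    let f := prod.lift (pullback.fst R.p₂ S.p₁ ≫ R.p₁) (pullback.snd R.p₂ S.p₁ ≫ S.p₂)
    let q : pullback R.p₂ S.p₁ ⟶ image f := factorThruImage f
    have hq : q ≫ image.ι f = f := image.fac f
    have : IsRegularEpi q := Regular.isRegularEpi_of_extremalEpi q
    obtain ⟨g, hg⟩ : ∃ g : T ⟶ image f, g ≫ image.ι f = prod.lift a b :=
      (Subobject.mk_factors_iff (image.ι f) (prod.lift a b)).1 h
    have w : pullback.fst g q ≫ prod.lift a b = pullback.snd g q ≫ f := by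
      rw [← hg, pullback.condition_assoc, hq]
    have w₁ := congrArg (· ≫ prod.fst) w
    have w₂ := congrArg (· ≫ prod.snd) w
    simp only [f, Category.assoc, prod.lift_fst, prod.lift_snd] at w₁ w₂
    refine ⟨_, pullback.fst g q, inferInstance,
      pullback.snd g q ≫ pullback.fst R.p₂ S.p₁ ≫ R.p₂, ?_, ?_⟩
    · exact (R.holds_iff _ _).2 ⟨pullback.snd g q ≫ pullback.fst R.p₂ S.p₁, by simp [w₁], by simp⟩
    · exact (S.holds_iff _ _).2 ⟨pullback.snd g q ≫ pullback.snd R.p₂ S.p₁,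
        by simp [pullback.condition], by simp [w₂]⟩
  · rintro ⟨T', e, _, c, h₁, h₂⟩
    exact EqRel.Holds.of_comp_regularEpi e (compRel_factors R S h₁ h₂)

instance : IsModularLattice (EqRel X) where
  sup_inf_le_assoc_of_le {R} S {T} hRT := (EqRel.le_iff_holds _ _).2 fun a b h => by
    obtain ⟨h₁, h₂⟩ := EqRel.inf_holds_iff.1 h
    obtain ⟨T', e, he, c, hac, hcb⟩ := EqRel.sup_holds_iff.1 h₁
    exact EqRel.sup_holds_iff.2 ⟨T', e, he, c, hac, EqRel.inf_holds_iff.2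
      ⟨hcb, T.trans (T.symm ((EqRel.le_iff_holds _ _).1 hRT _ _ hac)) (h₂.comp e)⟩⟩

theorem square_sup {R T S : EqRel X} (h : S ⊓ (R ⊔ T) = S ⊓ R ⊔ S ⊓ T) :
    square (R ⊔ T) S = square R S ⊔ square T S := by
  refine le_antisymm ((EqRel.le_iff_holds _ _).2 fun {V} a b hab => ?_)
    (sup_le (square_mono S le_sup_left) (square_mono S le_sup_right))
  have holds_of_le {P Q : EqRel X} (hPQ : P ≤ Q) {W : C} {x y : W ⟶ X} (hxy : P.Holds x y) :
      Q.Holds x y := (EqRel.le_iff_holds P Q).1 hPQ x y hxy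
  have hS {W : C} (c : W ⟶ S.dom) : S.Holds (c ≫ S.p₁) (c ≫ S.p₂) :=
    (S.holds_iff _ _).2 ⟨c, rfl, rfl⟩
  obtain ⟨h₁, h₂⟩ := square_holds_iff.1 hab
  obtain ⟨V₁, e₁, _, x, hax, hxb⟩ := EqRel.sup_holds_iff.1 h₁
  obtain ⟨V₂, e₂, _, y, hay, hyb⟩ := EqRel.sup_holds_iff.1 (h₂.comp e₁)
  have hR : (S ⊔ R).Holds (e₂ ≫ x) y :=
    (S ⊔ R).trans (holds_of_le le_sup_right (R.symm (hax.comp e₂)))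
      ((S ⊔ R).trans (holds_of_le le_sup_left (((hS a).comp e₁).comp e₂))
        (holds_of_le le_sup_right hay))
  have hT : (S ⊔ T).Holds (e₂ ≫ x) y :=
    (S ⊔ T).trans (holds_of_le le_sup_right (hxb.comp e₂))
      ((S ⊔ T).trans (holds_of_le le_sup_left (((hS b).comp e₁).comp e₂))
        (holds_of_le le_sup_right (T.symm hyb)))
  obtain ⟨V₃, e₃, _, w, hxw, hwy⟩ := EqRel.sup_holds_iff.1
    (holds_of_le (sup_inf_sup_le_of_inf_sup_eq h) (EqRel.inf_holds_iff.2 ⟨hR, hT⟩))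
  obtain ⟨hwyR, hwyT⟩ := EqRel.inf_holds_iff.1 hwy
  obtain ⟨c, hc₁, hc₂⟩ := (S.holds_iff _ _).1 hxw
  have hac : (square R S).Holds (e₃ ≫ e₂ ≫ e₁ ≫ a) c := by
    rw [square_holds_iff, hc₁, hc₂]
    simp only [Category.assoc]
    exact ⟨(hax.comp e₂).comp e₃, R.trans (hay.comp e₃) (R.symm hwyR)⟩
  have hcb : (square T S).Holds c (e₃ ≫ e₂ ≫ e₁ ≫ b) := by
    rw [square_holds_iff, hc₁, hc₂]
    simp only [Category.assoc]
    exact ⟨(hxb.comp e₂).comp e₃, T.trans hwyT (hyb.comp e₃)⟩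
  have hV : (square R S ⊔ square T S).Holds (e₃ ≫ e₂ ≫ e₁ ≫ a) (e₃ ≫ e₂ ≫ e₁ ≫ b) :=
    compRel_factors _ _ hac hcb
  exact .of_comp_regularEpi e₁ (.of_comp_regularEpi e₂ (.of_comp_regularEpi e₃ hV))

theorem square_finset_sup {α : Type*} [DecidableEq α] {S : EqRel X} {A : α → EqRel X}
    (h : ∀ s : Finset α, S ⊓ s.sup A = s.sup fun i => S ⊓ A i) (s : Finset α) :
    square (s.sup A) S = s.sup fun i => square (A i) S := by
  induction s using Finset.induction_on with
  | empty => exact square_bot S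
  | insert a s _ ih =>
    rw [Finset.sup_insert, Finset.sup_insert, ← ih]
    refine square_sup ?_
    rw [← Finset.sup_insert, h, h, Finset.sup_insert]

/-- The distributive law with the join indexed by an arbitrary finite set; the law for the empty
join holds as well, since both sides are the diagonal. -/
theorem IsDistributive.inf_sup_eq {ι : Type*} [DecidableEq ι] {R : ι → EqRel X}
    (hR : IsDistributive R) {α : Type*} (J₀ : Finset ι) (J : α → Finset ι)
    (hJ₀ : ∀ i, Disjoint J₀ (J i)) (hJ : ∀ i j, i ≠ j → Disjoint (J i) (J j)) (s : Finset α) :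
    J₀.inf R ⊓ s.sup (fun i => (J i).inf R) = s.sup fun i => J₀.inf R ⊓ (J i).inf R := by
  rcases s.eq_empty_or_nonempty with rfl | hs
  · simp
  let e : Fin s.card ↪ α := s.equivFin.symm.toEmbedding.trans (Function.Embedding.subtype _)
  have he : Finset.univ.map e = s := by
    rw [← Finset.map_map, Finset.map_univ_equiv]
    exact s.attach_map_val
  have key := hR s.card hs.card_pos (Fin.cons J₀ fun i => J (e i)) (by
    intro i j hij
    cases i using Fin.cases with
    | zero =>
      cases j using Fin.cases with
      | zero => exact absurd rfl hij
      | succ j => exact hJ₀ _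
    | succ i =>
      cases j using Fin.cases with
      | zero => exact (hJ₀ _).symm
      | succ j => exact hJ _ _ fun h => hij (congrArg Fin.succ (e.injective h)))
  simp only [Fin.cons_zero, Fin.cons_succ, Finset.inf_union] at key
  rw [← he, Finset.sup_map, Finset.sup_map]
  exact key

theorem IsDistributive.square {ι : Type*} [DecidableEq ι] {R : ι → EqRel X}
    (hR : IsDistributive R) (m : ι) :
    IsDistributive (fun i : {i : ι // i ≠ m} => square (R i) (R m)) := by
  intro k _ J hJ
  let J' (i : Fin (k + 1)) : Finset ι := (J i).map (Function.Embedding.subtype _)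
  have hJ' (i j) (hij : i ≠ j) : Disjoint (J' i) (J' j) :=
    (Finset.disjoint_map _).2 (hJ i j hij)
  have hm (i) : Disjoint {m} (J' i) := by simp [J']
  have hinf (i) : (J i).inf (fun i : {i : ι // i ≠ m} => ExactMaltsev.square (R i) (R m)) =
      ExactMaltsev.square ((J' i).inf R) (R m) := by
    rw [square_finset_inf, Finset.inf_map]
    rfl
  have h0 (i : Fin k) : (0 : Fin (k + 1)) ≠ i.succ := (Fin.succ_ne_zero i).symm
  have hsucc (i j : Fin k) (hij : i ≠ j) : Disjoint (J' i.succ) (J' j.succ) :=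
    hJ' _ _ fun h => hij (Fin.succ_injective k h)
  have dist (s : Finset (Fin k)) := hR.inf_sup_eq (J' 0) (fun i => J' i.succ)
    (fun i => hJ' _ _ (h0 i)) hsucc s
  have dist_m (s : Finset (Fin k)) := hR.inf_sup_eq {m} (fun i : Fin k => J' i.succ)
    (fun i => hm _) hsucc s
  have dist_m0 (s : Finset (Fin k)) := hR.inf_sup_eq ({m} ∪ J' 0) (fun i => J' i.succ)
    (fun i => Finset.disjoint_union_left.2 ⟨hm _, hJ' _ _ (h0 i)⟩) hsucc s
  simp only [Finset.inf_union, Finset.inf_singleton] at dist_m dist_m0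
  simp only [Finset.inf_union, hinf, ← square_inf]
  rw [← square_finset_sup dist_m, ← square_inf, dist]
  exact square_finset_sup (fun s => by rw [← dist, ← inf_assoc, dist_m0]; simp only [inf_assoc]) _

end Regular

end ExactMaltsev

theorem mainTheorem9 {C : Type u} [Category.{v} C] [ExactMaltsev.BarrExact C]
    [ExactMaltsev.IsMaltsev C] {n : ℕ} (hn : 4 ≤ n) {X : C} (R : Fin n → ExactMaltsev.EqRel X)
    (hR : ExactMaltsev.IsDistributive R) (m : Fin n) :
    ExactMaltsev.IsDistributive
      (fun i : {i : Fin n // i ≠ m} => ExactMaltsev.square (R i) (R m)) :=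
  hR.square m
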